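/- Let $m$ and $r$ be natural numbers with $\lfloor \frac{m-1}{2} \rfloor < r \le m-2$, let $n = 2^m$, and let $\mathcal R(r,m) \subseteq \mathbb F_2^{n}$ be the binary Reed–Muller code of order $r$, that is, the set of vectors $(f(x))_{x \in \mathbb F_2^m}$, where $f$ runs over the polynomials in $m$ variables over $\mathbb F_2$ of total degree at most $r$ and the points of $\mathbb F_2^m$ are listed in any fixed order. Let $k$ be the dimension of $\mathcal R(r,m)$. A linear code is called self-orthogonal if it is contained in its dual with respect to the standard dot product. An SO embedding of a binary linear code $\mathcal C$ is a self-orthogonal binary linear code $\tilde{\mathcal C}$ such that puncturing $\tilde{\mathcal C}$ on some (possibly empty) set of coordinates, i.e. deleting these coordinates from all codewords, gives $\mathcal C$; it is called a shortest SO embedding if its length is least among all SO embeddings of $\mathcal C$. Then $\mathcal R(r,m)$ has a shortest SO embedding, and every shortest SO embedding of $\mathcal R(r,m)$ has length exactly $2k+1$. -/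

import Mathlib

/-- A binary linear code of length `n`: a linear subspace of `𝔽₂ⁿ`. -/
abbrev BinaryCode (n : ℕ) : Type := Submodule (ZMod 2) (Fin n → ZMod 2)

namespace BinaryCode

/-- The dual code `{x | x ⬝ y = 0 for all y ∈ C}`. -/
def dual {n : ℕ} (C : BinaryCode n) : BinaryCode n where
  carrier := {x | ∀ y ∈ C, x ⬝ᵥ y = 0}
  zero_mem' := fun y _ => zero_dotProduct y
  add_mem' := fun {a b} ha hb y hy => by
    rw [add_dotProduct, ha y hy, hb y hy, add_zero]
  smul_mem' := fun c x hx y hy => by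
    rw [smul_dotProduct, hx y hy, smul_zero]

/-- A code is self-orthogonal if it is contained in its dual. -/
def IsSelfOrthogonal {n : ℕ} (C : BinaryCode n) : Prop := C ≤ dual C

/-- The code `D` of length `N` punctured on the set of coordinates `S`: the coordinates in `S`
are deleted from every codeword, and the `n` remaining ones keep their order. -/
def puncture {N n : ℕ} (D : BinaryCode N) (S : Finset (Fin N)) (h : Sᶜ.card = n) :
    BinaryCode n :=
  Submodule.map (LinearMap.funLeft (ZMod 2) (ZMod 2) (Sᶜ.orderEmbOfFin h)) D

/-- `D` is an SO embedding of `C`: it is self-orthogonal, and puncturing it on some set of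
coordinates gives `C`. (This forces `n ≤ N`.) -/
def IsSOEmbedding {n N : ℕ} (C : BinaryCode n) (D : BinaryCode N) : Prop :=
  IsSelfOrthogonal D ∧ ∃ (S : Finset (Fin N)) (h : Sᶜ.card = n), puncture D S h = C

/-- `D` is an SO embedding of `C` whose length is least among all SO embeddings of `C`. -/
def IsShortestSOEmbedding {n N : ℕ} (C : BinaryCode n) (D : BinaryCode N) : Prop :=
  IsSOEmbedding C D ∧ ∀ (N' : ℕ) (D' : BinaryCode N'), IsSOEmbedding C D' → N ≤ N'

/-- The binary Reed–Muller code of order `r` and length `2 ^ m`: the vectors of values, at the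
points of `𝔽₂ᵐ` listed by the enumeration `e`, of the polynomials in `m` variables over `𝔽₂`
of total degree at most `r`. -/
noncomputable def reedMuller (r m : ℕ) (e : Fin (2 ^ m) ≃ (Fin m → ZMod 2)) :
    BinaryCode (2 ^ m) :=
  Submodule.map
    (LinearMap.funLeft (ZMod 2) (ZMod 2) e ∘ₗ MvPolynomial.evalₗ (ZMod 2) (Fin m))
    (MvPolynomial.restrictTotalDegree (Fin m) (ZMod 2) r)

end BinaryCode

namespace BinaryCode

/-! Here `C = R(r,m)` is even and strictly contains its dual, so `n < 2k`. Upper bound: on `C` the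
dot product is alternating with radical `dual C`, so its rank is `2k - n`.
`exists_dotProduct_eq_of_isAlt` realises it in at most `2k - n + 1` coordinates; appending them to
`C` cancels all products, with total length at most `2k + 1`. Lower bound
(`two_mul_finrank_lt_of_isSOEmbedding`): at length at most `2k` the embedding is self-dual and
puncturing is injective on it. Evenness of `C` puts the indicator of the kept coordinates in the
embedding, next to the all-ones word. Both puncture to the same word, so nothing was deleted and `n
= 2k`, a contradiction. -/

theorem dotProduct_self_eq_sum {ι : Type*} [Fintype ι] (x : ι → ZMod 2) : x ⬝ᵥ x = ∑ i, x i := by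
  refine Finset.sum_congr rfl fun i _ => ?_
  generalize x i = a
  revert a
  decide

theorem finrank_dual {n : ℕ} (C : BinaryCode n) :
    Module.finrank (ZMod 2) (dual C) + Module.finrank (ZMod 2) C = n := by
  let B : LinearMap.BilinForm (ZMod 2) (Fin n → ZMod 2) := dotProductBilin (ZMod 2) (ZMod 2)
  have hB : ∀ x y, B x y = x ⬝ᵥ y := fun _ _ => rfl
  have hrefl : B.IsRefl := fun x y h => by rw [hB, dotProduct_comm]; exact h
  have hnd : B.Nondegenerate := by
    refine (LinearMap.IsRefl.nondegenerate_iff_separatingLeft hrefl).2 fun x hx => ?_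
    exact dotProduct_eq_zero x hx
  have key := LinearMap.BilinForm.finrank_orthogonal hnd C
  have heq : B.orthogonal C = dual C := by
    ext x
    rw [LinearMap.BilinForm.mem_orthogonal_iff]
    refine forall₂_congr fun y _ => ?_
    change y ⬝ᵥ x = 0 ↔ _
    rw [dotProduct_comm]
  rw [heq, Module.finrank_fin_fun] at key
  have hle : Module.finrank (ZMod 2) C ≤ n := by
    simpa using Submodule.finrank_le C
  omega

theorem two_mul_finrank_le_of_isSelfOrthogonal {n : ℕ} {D : BinaryCode n}
    (hD : IsSelfOrthogonal D) : 2 * Module.finrank (ZMod 2) D ≤ n := by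
  have h1 := finrank_dual D
  have h2 := Submodule.finrank_mono hD
  omega

/-! ### Alternating forms over `𝔽₂` as dot products -/

/-- An alternating form over `𝔽₂` is the pullback of the standard dot product along a linear map
into a space of odd dimension at most one more than its rank. -/
theorem exists_dotProduct_eq_of_isAlt {V : Type*} [AddCommGroup V] [Module (ZMod 2) V]
    [FiniteDimensional (ZMod 2) V] (c : ℕ) (B : LinearMap.BilinForm (ZMod 2) V) (hB : B.IsAlt)
    (hc : Module.finrank (ZMod 2) V ≤ Module.finrank (ZMod 2) (LinearMap.ker B) + c) :
    ∃ (s : ℕ) (φ : V →ₗ[ZMod 2] (Fin (2 * s + 1) → ZMod 2)),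
      2 * s ≤ c ∧ ∀ x y, φ x ⬝ᵥ φ y = B x y := by
  induction c using Nat.strong_induction_on generalizing B with
  | _ c ih =>
  by_cases h0 : B = 0
  · exact ⟨0, 0, by simp, by simp [h0]⟩
  obtain ⟨u, v, huv⟩ : ∃ u v, B u v = 1 := by
    by_contra! h
    refine h0 (LinearMap.ext₂ fun u v => ?_)
    have := h u v
    change B u v = 0
    revert this
    generalize B u v = a
    revert a
    decide
  have hsymm : ∀ x y, B x y = B y x := fun x y => by
    rw [← hB.neg_eq, ZMod.neg_eq_self_mod_two]
  let a : V →ₗ[ZMod 2] ZMod 2 := B u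
  let b : V →ₗ[ZMod 2] ZMod 2 := B v
  -- Split off the hyperbolic plane of `u, v`: both vectors enter the radical, so the rank drops by
  -- at least two.
  let B' : LinearMap.BilinForm (ZMod 2) V := B + a.smulRight b + b.smulRight a
  have hB' : ∀ x y, B' x y = B x y + B u x * B v y + B v x * B u y := fun x y => rfl
  have hcancel : ∀ t : ZMod 2, t + t = 0 := CharTwo.add_self_eq_zero
  have halt : B'.IsAlt := fun x => by
    rw [hB', hB x, mul_comm (B v x), zero_add, hcancel]
  have hvu : B v u = 1 := by rw [hsymm, huv]
  have hker : LinearMap.ker B ≤ LinearMap.ker B' ⊓ LinearMap.ker a := fun x hx => by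
    have hx0 : ∀ y, B x y = 0 := fun y => by rw [LinearMap.mem_ker.1 hx]; rfl
    refine ⟨LinearMap.ext fun y => ?_, ?_⟩
    · rw [hB', hx0, hsymm u x, hsymm v x, hx0, hx0, zero_mul, zero_mul, add_zero, add_zero]; rfl
    · change B u x = 0
      rw [hsymm, hx0]
  have hu : u ∈ LinearMap.ker B' ⊓ LinearMap.ker a := by
    refine ⟨LinearMap.ext fun y => ?_, hB u⟩
    rw [hB', hB u, hvu, zero_mul, one_mul, add_zero, hcancel]; rfl
  have hv : v ∈ LinearMap.ker B' := by
    refine LinearMap.ext fun y => ?_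
    rw [hB', hB v, huv, zero_mul, one_mul, add_zero, hcancel]; rfl
  have hlt1 : LinearMap.ker B < LinearMap.ker B' ⊓ LinearMap.ker a :=
    lt_of_le_of_ne hker fun h => by
      rw [← h, LinearMap.mem_ker] at hu
      rw [hu] at huv
      exact zero_ne_one huv
  have hlt2 : LinearMap.ker B' ⊓ LinearMap.ker a < LinearMap.ker B' :=
    lt_of_le_of_ne inf_le_left fun h => by
      rw [← h] at hv
      have : B u v = 0 := hv.2
      rw [this] at huv
      exact zero_ne_one huv
  have hf1 := Submodule.finrank_lt_finrank_of_lt hlt1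
  have hf2 := Submodule.finrank_lt_finrank_of_lt hlt2
  have hf3 := Submodule.finrank_le (LinearMap.ker B')
  obtain ⟨s, φ, hs, hφ⟩ := ih (c - 2) (by omega) B' halt (by omega)
  -- The new coordinates `a, b` contribute `aa' + bb'` where `ab' + ba'` is needed; the error is `(a
  -- + b)(a' + b')`. Adding `(a + b) • 1` supplies it: `1 ⬝ᵥ 1 = 1` in odd length, and `φ x` is
  -- orthogonal to `1` since `B'` is alternating.
  let ψ : V →ₗ[ZMod 2] (Fin (2 * s + 1) → ZMod 2) := φ + (a + b).smulRight 1
  refine ⟨s + 1, LinearMap.pi (Fin.cons a (Fin.cons b fun i => LinearMap.proj i ∘ₗ ψ)), by omega,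
    fun x y => ?_⟩
  have hφ1 : ∀ x, ∑ i, φ x i = 0 := fun x => by
    rw [← dotProduct_self_eq_sum, hφ, halt x]
  have hcard : ((2 * s + 1 : ℕ) : ZMod 2) = 1 := by
    push_cast
    rw [show (2 : ZMod 2) = 0 from rfl]
    simp
  have hψ : ψ x ⬝ᵥ ψ y = B' x y + (B u x + B v x) * (B u y + B v y) := by
    have h1 : ∀ x, ψ x = φ x + (B u x + B v x) • 1 := fun x => rfl
    rw [h1, h1]
    simp only [add_dotProduct, dotProduct_add, smul_dotProduct, dotProduct_smul, hφ,
      dotProduct_one, one_dotProduct, hφ1, smul_eq_mul]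
    simp only [Pi.add_apply, Pi.smul_apply, Pi.one_apply, Finset.sum_add_distrib, hφ1,
      Finset.sum_const, Finset.card_univ, Fintype.card_fin, nsmul_eq_mul, hcard, smul_eq_mul]
    ring
  have hsplit : ∀ f g : Fin (2 * (s + 1) + 1) → ZMod 2,
      f ⬝ᵥ g = f 0 * g 0 + (f 1 * g 1 + ∑ i : Fin (2 * s + 1), f i.succ.succ * g i.succ.succ) :=
    fun f g => by
      change ∑ i : Fin ((2 * s + 1) + 1 + 1), f i * g i = _
      rw [Fin.sum_univ_succ]
      congr 1
      exact Fin.sum_univ_succ (n := 2 * s + 1) _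
  rw [hsplit]
  change B u x * B u y + (B v x * B v y + ψ x ⬝ᵥ ψ y) = B x y
  rw [hψ, hB']
  linear_combination (B u x * B u y + B v x * B v y + B u x * B v y + B v x * B u y) *
    hcancel 1

/-! ### Bounds on the length of SO embeddings -/

/-- A self-orthogonal extension of `C` by `l` coordinates, from an isometry. -/
theorem exists_isSOEmbedding_of_dotProduct_eq {n l : ℕ} (C : BinaryCode n)
    (φ : C →ₗ[ZMod 2] (Fin l → ZMod 2))
    (hφ : ∀ x y : C, φ x ⬝ᵥ φ y = (x : Fin n → ZMod 2) ⬝ᵥ y) :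
    ∃ D : BinaryCode (n + l), IsSOEmbedding C D := by
  let ψ : C →ₗ[ZMod 2] (Fin (n + l) → ZMod 2) :=
    LinearMap.pi (Fin.append (fun i => LinearMap.proj i ∘ₗ C.subtype)
      fun i => LinearMap.proj i ∘ₗ φ)
  have hψl : ∀ x i, ψ x (Fin.castAdd l i) = (x : Fin n → ZMod 2) i := fun x i => by
    simp [ψ]
  have hψr : ∀ x i, ψ x (Fin.natAdd n i) = φ x i := fun x i => by
    simp [ψ]
  refine ⟨LinearMap.range ψ, ?_, (Finset.univ.map (Fin.castAddEmb l))ᶜ, by simp, ?_⟩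
  · rintro _ ⟨x, rfl⟩ _ ⟨y, rfl⟩
    have : ψ x ⬝ᵥ ψ y = (x : Fin n → ZMod 2) ⬝ᵥ y + φ x ⬝ᵥ φ y := by
      simp only [dotProduct, Fin.sum_univ_add, hψl, hψr]
    rw [this, hφ, CharTwo.add_self_eq_zero]
  · have hemb : ∀ (h : ((Finset.univ : Finset (Fin n)).map (Fin.castAddEmb l))ᶜᶜ.card = n) i,
        ((Finset.univ.map (Fin.castAddEmb l))ᶜᶜ.orderEmbOfFin h) i = Fin.castAdd l i := fun h i => by
      refine (congrFun (Finset.orderEmbOfFin_unique h (f := Fin.castAdd l) (fun x => by simp)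
        (Fin.strictMono_castAdd l)) i).symm
    rw [puncture, ← LinearMap.range_comp]
    have : (LinearMap.funLeft (ZMod 2) (ZMod 2)
        ((Finset.univ.map (Fin.castAddEmb l))ᶜᶜ.orderEmbOfFin (by simp)) ∘ₗ ψ) = C.subtype := by
      ext x i
      simp only [LinearMap.comp_apply, LinearMap.funLeft_apply, hemb, hψl, Submodule.subtype_apply]
    rw [this, Submodule.range_subtype]

/-- An even code containing its dual has an SO embedding of length at most twice its dimension
plus one. -/
theorem exists_isSOEmbedding_of_dual_le {n : ℕ} (C : BinaryCode n)
    (heven : ∀ x ∈ C, ∑ i, x i = 0) (hdual : dual C ≤ C) :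
    ∃ N ≤ 2 * Module.finrank (ZMod 2) C + 1, ∃ D : BinaryCode N, IsSOEmbedding C D := by
  let B : LinearMap.BilinForm (ZMod 2) C :=
    LinearMap.BilinForm.restrict (dotProductBilin (ZMod 2) (ZMod 2)) C
  have hB : ∀ x y : C, B x y = (x : Fin n → ZMod 2) ⬝ᵥ y := fun _ _ => rfl
  have hker : LinearMap.ker B = (dual C).comap C.subtype := by
    ext x
    constructor
    · intro hx y hy
      rw [LinearMap.mem_ker] at hx
      exact LinearMap.congr_fun hx ⟨y, hy⟩
    · intro hx
      exact LinearMap.ext fun y => hx y y.2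
  have hrank : Module.finrank (ZMod 2) (LinearMap.ker B) = Module.finrank (ZMod 2) (dual C) := by
    rw [hker]
    exact (Submodule.comapSubtypeEquivOfLe hdual).finrank_eq
  have hdim := finrank_dual C
  have hle := Submodule.finrank_mono hdual
  obtain ⟨s, φ, hs, hφ⟩ := exists_dotProduct_eq_of_isAlt
    (2 * Module.finrank (ZMod 2) C - n) B
    (fun x => by rw [hB, dotProduct_self_eq_sum]; exact heven x x.2) (by omega)
  exact ⟨n + (2 * s + 1), by omega, exists_isSOEmbedding_of_dotProduct_eq C φ hφ⟩

/-- An even code of dimension more than half its length has no SO embedding of length at most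
twice its dimension. -/
theorem two_mul_finrank_lt_of_isSOEmbedding {n N : ℕ} {C : BinaryCode n} {D : BinaryCode N}
    (heven : ∀ x ∈ C, ∑ i, x i = 0) (hdim : n < 2 * Module.finrank (ZMod 2) C)
    (h : IsSOEmbedding C D) : 2 * Module.finrank (ZMod 2) C + 1 ≤ N := by
  obtain ⟨hD, S, hS, hC⟩ := h
  have hDN := two_mul_finrank_le_of_isSelfOrthogonal hD
  have hCD : Module.finrank (ZMod 2) C ≤ Module.finrank (ZMod 2) D := by
    rw [← hC]; exact Submodule.finrank_map_le _ _
  by_contra! hlt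
  have hdual := finrank_dual D
  have hDD : D = dual D := Submodule.eq_of_le_of_finrank_eq hD (by omega)
  set π := LinearMap.funLeft (ZMod 2) (ZMod 2) (Sᶜ.orderEmbOfFin hS) with hπ
  have hπC : ∀ d ∈ D, π d ∈ C := fun d hd => hC ▸ Submodule.mem_map_of_mem hd
  have hker : ∀ d ∈ D, π d = 0 → d = 0 := by
    have hrange : LinearMap.range (π.domRestrict D) = C := by
      rw [LinearMap.range_domRestrict]; exact hC
    have hrn := LinearMap.finrank_range_add_finrank_ker (π.domRestrict D)
    rw [hrange] at hrn
    have hbot : LinearMap.ker (π.domRestrict D) = ⊥ := Submodule.finrank_eq_zero.1 (by omega)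
    intro d hd h0
    have : (⟨d, hd⟩ : D) ∈ LinearMap.ker (π.domRestrict D) := h0
    rw [hbot, Submodule.mem_bot] at this
    exact congrArg Subtype.val this
  have h1 : (1 : Fin N → ZMod 2) ∈ D := by
    rw [hDD]
    intro d hd
    rw [one_dotProduct, ← dotProduct_self_eq_sum]
    exact hD hd d hd
  -- Pairing with this indicator sums the punctured word, which lies in the even code `C`.
  have hw : (fun i => if i ∈ Sᶜ then (1 : ZMod 2) else 0) ∈ D := by
    rw [hDD]
    intro d hd
    have hsum := heven _ (hπC d hd)
    have : ∑ i, π d i = ∑ i ∈ Sᶜ, d i := by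
      rw [← Finset.map_orderEmbOfFin_univ Sᶜ hS, Finset.sum_map]; rfl
    rw [this] at hsum
    simp only [dotProduct, ite_mul, one_mul, zero_mul]
    rw [← Finset.sum_filter, Finset.filter_mem_eq_inter, Finset.univ_inter, hsum]
  have hzero := hker _ (D.sub_mem h1 hw) (by
    ext j
    have := Finset.orderEmbOfFin_mem Sᶜ hS j
    rw [hπ, LinearMap.funLeft_apply, Pi.sub_apply, if_pos this]
    simp)
  have hSu : Sᶜ = Finset.univ := by
    refine Finset.eq_univ_iff_forall.2 fun i => ?_
    by_contra hi
    have := congrFun hzero i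
    rw [Pi.sub_apply, if_neg hi] at this
    simp at this
  rw [hSu, Finset.card_univ, Fintype.card_fin] at hS
  omega

/-! ### Sums of polynomial values over `𝔽₂ᵐ` -/

theorem sum_zmod_two_pow (a : ℕ) : ∑ x : ZMod 2, x ^ a = if a = 0 then 0 else 1 := by
  rw [show (Finset.univ : Finset (ZMod 2)) = {0, 1} from rfl, Finset.sum_pair zero_ne_one, one_pow]
  split_ifs with h
  · subst h; rfl
  · rw [zero_pow h, zero_add]

theorem sum_prod_pow {m : ℕ} (s : Fin m →₀ ℕ) :
    ∑ x : Fin m → ZMod 2, ∏ i, x i ^ s i = if ∀ i, s i ≠ 0 then 1 else 0 := by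
  have := Finset.prod_univ_sum (fun _ : Fin m => (Finset.univ : Finset (ZMod 2)))
    (fun i x => x ^ s i)
  rw [Fintype.piFinset_univ] at this
  rw [← this]
  simp only [sum_zmod_two_pow]
  split_ifs with h
  · exact Finset.prod_eq_one fun i _ => if_neg (h i)
  · push Not at h
    obtain ⟨i, hi⟩ := h
    exact Finset.prod_eq_zero (Finset.mem_univ i) (if_pos hi)

/-- The sum of the values of a polynomial counts its monomials divisible by every variable. -/
theorem sum_eval {m : ℕ} (p : MvPolynomial (Fin m) (ZMod 2)) :
    ∑ x, MvPolynomial.eval x p =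
      ∑ s ∈ p.support, if ∀ i, s i ≠ 0 then p.coeff s else 0 := by
  simp only [MvPolynomial.eval_eq']
  rw [Finset.sum_comm]
  refine Finset.sum_congr rfl fun s _ => ?_
  rw [← Finset.mul_sum, sum_prod_pow, mul_ite, mul_one, mul_zero]

theorem sum_eval_eq_zero_of_totalDegree_lt {m : ℕ} (p : MvPolynomial (Fin m) (ZMod 2))
    (hp : p.totalDegree < m) : ∑ x, MvPolynomial.eval x p = 0 := by
  rw [sum_eval]
  refine Finset.sum_eq_zero fun s hs => if_neg fun h => ?_
  have h1 := MvPolynomial.le_totalDegree hs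
  rw [Finsupp.sum_fintype _ _ (fun _ => rfl)] at h1
  have h2 : ∑ _i : Fin m, 1 ≤ ∑ i, s i :=
    Finset.sum_le_sum fun i _ => Nat.one_le_iff_ne_zero.2 (h i)
  simp at h2
  omega

/-! ### Reed–Muller codes -/

section ReedMuller

variable {r m : ℕ} {e : Fin (2 ^ m) ≃ (Fin m → ZMod 2)}

theorem mem_reedMuller {x : Fin (2 ^ m) → ZMod 2} :
    x ∈ reedMuller r m e ↔ ∃ p : MvPolynomial (Fin m) (ZMod 2),
      p.totalDegree ≤ r ∧ ∀ j, MvPolynomial.eval (e j) p = x j := by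
  simp only [reedMuller, Submodule.mem_map, MvPolynomial.mem_restrictTotalDegree]
  refine exists_congr fun p => and_congr_right fun _ => funext_iff

theorem sum_eq_zero_of_mem_reedMuller (hr : r < m) {x : Fin (2 ^ m) → ZMod 2}
    (hx : x ∈ reedMuller r m e) : ∑ j, x j = 0 := by
  obtain ⟨p, hp, hpx⟩ := mem_reedMuller.1 hx
  simp only [← hpx]
  rw [e.sum_comp fun y => MvPolynomial.eval y p]
  exact sum_eval_eq_zero_of_totalDegree_lt p (by omega)

/-- A reduced polynomial of degree above `r` is detected by the complement of one of its top-degree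
monomials, whose degree is below `m - r`, hence at most `r`. -/
theorem dual_reedMuller_le (hr : m ≤ 2 * r + 1) :
    dual (reedMuller r m e) ≤ reedMuller r m e := by
  intro x hx
  have htop : (fun y => x (e.symm y)) ∈
      (MvPolynomial.restrictDegree (Fin m) (ZMod 2) (Fintype.card (ZMod 2) - 1)).map
        (MvPolynomial.evalₗ (ZMod 2) (Fin m)) := by
    rw [MvPolynomial.map_restrict_dom_evalₗ]; trivial
  obtain ⟨p, hp, hpx⟩ := htop
  have hpx' : ∀ y, MvPolynomial.eval y p = x (e.symm y) := congrFun hpx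
  have hp1 : ∀ s ∈ p.support, ∀ i, s i ≤ 1 := (MvPolynomial.mem_restrictDegree _ _ _).1 hp
  refine mem_reedMuller.2 ⟨p, ?_, fun j => by simp [hpx']⟩
  by_contra! hdeg
  have hne : p.support.Nonempty := by
    rw [Finset.nonempty_iff_ne_empty, Ne, MvPolynomial.support_eq_empty]
    rintro rfl
    simp at hdeg
  obtain ⟨s, hs, hsdeg⟩ := Finset.exists_mem_eq_sup p.support hne fun s => s.sum fun _ e => e
  change p.totalDegree = _ at hsdeg
  rw [Finsupp.sum_fintype _ _ (fun _ => rfl)] at hsdeg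
  let t : Fin m →₀ ℕ := Finsupp.equivFunOnFinite.symm fun i => 1 - s i
  have ht : ∀ i, t i = 1 - s i := fun i => rfl
  have htsum : ∑ i, t i + ∑ i, s i = m := by
    rw [← Finset.sum_add_distrib]
    calc ∑ i, (t i + s i) = ∑ _i : Fin m, 1 :=
          Finset.sum_congr rfl fun i _ => by have := hp1 s hs i; rw [ht]; omega
      _ = m := by simp
  let q : MvPolynomial (Fin m) (ZMod 2) := MvPolynomial.monomial t 1
  have hq : q.totalDegree ≤ r := by
    refine (MvPolynomial.totalDegree_monomial_le _ _).trans ?_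
    rw [Finsupp.sum_fintype _ _ (fun _ => rfl)]
    change ∑ i, t i ≤ r
    omega
  have horth := hx (fun j => MvPolynomial.eval (e j) q)
    (mem_reedMuller.2 ⟨q, hq, fun _ => rfl⟩)
  have hsum : ∑ y, MvPolynomial.eval y p * MvPolynomial.eval y q = 0 := by
    rw [← horth, dotProduct, ← e.sum_comp]
    simp [hpx']
  have hkey : ∑ y, MvPolynomial.eval y p * MvPolynomial.eval y q =
      ∑ s' ∈ p.support, p.coeff s' * if ∀ i, (s' + t) i ≠ 0 then 1 else 0 := by
    simp only [← sum_prod_pow, Finset.mul_sum]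
    rw [Finset.sum_comm]
    refine Finset.sum_congr rfl fun y _ => ?_
    rw [MvPolynomial.eval_eq', Finset.sum_mul]
    refine Finset.sum_congr rfl fun s' _ => ?_
    rw [MvPolynomial.eval_monomial, one_mul, Finsupp.prod_fintype _ _ (fun _ => pow_zero _),
      mul_assoc, ← Finset.prod_mul_distrib]
    simp only [Finsupp.add_apply, pow_add]
  -- Any surviving `s'` is divisible by `s`; as `s` has maximal degree, `s' = s`.
  rw [hkey, Finset.sum_eq_single s, if_pos, mul_one] at hsum
  · exact MvPolynomial.mem_support_iff.1 hs hsum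
  · intro i
    rw [Finsupp.add_apply, ht]
    omega
  · intro s' hs' hss'
    rw [if_neg, mul_zero]
    intro hall
    refine hss' ?_
    have hle : ∀ i, s i ≤ s' i := fun i => by
      have h1 := hall i
      have h2 := hp1 s hs i
      rw [Finsupp.add_apply, ht] at h1
      omega
    have hdle := MvPolynomial.le_totalDegree hs'
    rw [Finsupp.sum_fintype _ _ (fun _ => rfl), hsdeg] at hdle
    have heq := (Finset.sum_eq_sum_iff_of_le fun i _ => hle i).1
      (le_antisymm (Finset.sum_le_sum fun i _ => hle i) hdle)
    exact Finsupp.ext fun i => (heq i (Finset.mem_univ i)).symm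
  · exact fun h => absurd hs h

/-- The product of all variables splits into factors of degrees `r` and `m - r ≤ r`, and its values
sum to `1`. -/
theorem not_isSelfOrthogonal_reedMuller (hr : r ≤ m) (hr' : m ≤ 2 * r) :
    ¬ IsSelfOrthogonal (reedMuller r m e) := by
  intro h
  let s : Fin m →₀ ℕ := Finsupp.equivFunOnFinite.symm fun i => if (i : ℕ) < r then 1 else 0
  let t : Fin m →₀ ℕ := Finsupp.equivFunOnFinite.symm fun i => if (i : ℕ) < r then 0 else 1
  have hst : ∀ i, (s + t) i = 1 := fun i => by
    change (if (i : ℕ) < r then 1 else 0) + (if (i : ℕ) < r then 0 else 1) = 1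
    split_ifs <;> rfl
  have hs : ∑ i, s i = r := by
    change ∑ i : Fin m, (if (i : ℕ) < r then 1 else 0) = r
    rw [Fin.sum_univ_eq_sum_range (fun i => if i < r then 1 else 0), ← Finset.sum_filter]
    have : (Finset.range m).filter (· < r) = Finset.range r := by
      ext i; simp; omega
    simp [this]
  have hst' : ∑ i, s i + ∑ i, t i = m := by
    rw [← Finset.sum_add_distrib]
    simpa using Finset.sum_congr rfl fun i (_ : i ∈ Finset.univ) => hst i
  have hmem : ∀ u : Fin m →₀ ℕ, ∑ i, u i ≤ r →
      (fun j => MvPolynomial.eval (e j) (MvPolynomial.monomial u (1 : ZMod 2))) ∈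
        reedMuller r m e := fun u hu => by
    refine mem_reedMuller.2 ⟨_, (MvPolynomial.totalDegree_monomial_le _ _).trans ?_, fun _ => rfl⟩
    rwa [Finsupp.sum_fintype _ _ (fun _ => rfl)]
  have h0 := h (hmem s hs.le) _ (hmem t (by omega))
  have h1 : ∑ y : Fin m → ZMod 2, ∏ i, y i ^ (s + t) i = 0 := by
    rw [← h0, dotProduct, ← e.sum_comp]
    refine Finset.sum_congr rfl fun j _ => ?_
    rw [MvPolynomial.eval_monomial, MvPolynomial.eval_monomial, one_mul, one_mul,
      Finsupp.prod_fintype _ _ (fun _ => pow_zero _),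
      Finsupp.prod_fintype _ _ (fun _ => pow_zero _), ← Finset.prod_mul_distrib]
    simp only [Finsupp.add_apply, pow_add]
  rw [sum_prod_pow, if_pos fun i => by rw [hst]; exact one_ne_zero] at h1
  exact one_ne_zero h1

theorem lt_two_mul_finrank_reedMuller (hr : r ≤ m) (hr' : m ≤ 2 * r) :
    2 ^ m < 2 * Module.finrank (ZMod 2) (reedMuller r m e) := by
  have hlt : dual (reedMuller r m e) < reedMuller r m e :=
    lt_of_le_of_ne (dual_reedMuller_le (by omega)) fun h =>
      not_isSelfOrthogonal_reedMuller (e := e) hr hr' h.ge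
  have h1 := Submodule.finrank_lt_finrank_of_lt hlt
  have h2 := finrank_dual (reedMuller r m e)
  omega

end ReedMuller

end BinaryCode

theorem mainTheorem6 (r m k : ℕ) (hr : (m - 1) / 2 < r) (hrm : r + 2 ≤ m)
    (e : Fin (2 ^ m) ≃ (Fin m → ZMod 2))
    (hk : Module.finrank (ZMod 2) (BinaryCode.reedMuller r m e) = k) :
    (∃ D : BinaryCode (2 * k + 1),
      BinaryCode.IsShortestSOEmbedding (BinaryCode.reedMuller r m e) D) ∧
    ∀ (N : ℕ) (D : BinaryCode N),
      BinaryCode.IsShortestSOEmbedding (BinaryCode.reedMuller r m e) D → N = 2 * k + 1 := by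
  have heven : ∀ x ∈ BinaryCode.reedMuller r m e, ∑ j, x j = 0 := fun x hx =>
    BinaryCode.sum_eq_zero_of_mem_reedMuller (by omega) hx
  have hlow : ∀ (N : ℕ) (D : BinaryCode N),
      BinaryCode.IsSOEmbedding (BinaryCode.reedMuller r m e) D → 2 * k + 1 ≤ N := fun N D hD =>
    hk ▸ BinaryCode.two_mul_finrank_lt_of_isSOEmbedding heven
      (BinaryCode.lt_two_mul_finrank_reedMuller (by omega) (by omega)) hD
  obtain ⟨N, hN, D, hD⟩ := BinaryCode.exists_isSOEmbedding_of_dual_le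
    (BinaryCode.reedMuller r m e) heven (BinaryCode.dual_reedMuller_le (by omega))
  obtain rfl : N = 2 * k + 1 := le_antisymm (hk ▸ hN) (hlow N D hD)
  exact ⟨⟨D, hD, hlow⟩, fun N' D' hD' =>
    le_antisymm (hD'.2 _ D hD) (hlow N' D' hD'.1)⟩
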